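/- All digraphs are finite, without loops and without parallel arcs in the same direction (opposite arcs are allowed). For a digraph $D$ and vertex sets $A,B$, let $e(A,B)$ be the number of arcs directed from $A$ to $B$, and $e(A)=e(A,A)$. For a vertex $x$ let $d^+(x),d^-(x)$ be its outdegree and indegree, $d(x)=d^+(x)+d^-(x)$ and $s(x)=|d^+(x)-d^-(x)|$. A connected graph is *tight* if each of its blocks is a complete graph of odd order (a single vertex is tight); an *essential tight component* of a digraph is a connected component $T$ of its underlying simple graph which is tight and such that no two arcs between vertices of $T$ are opposite to each other. **Lemma 4.4.** Let $D$ be a digraph with $m$ arcs and minimum outdegree $d\ge 4$, and let $X,Y$ be a partition of $V(D)$ with $e(X)=0$. For a partition $X_1,X_2$ of $X$ (a part may be empty) put $$\theta(X_1,X_2)=\bigl(e(X_1,Y)+e(Y,X_2)\bigr)-\bigl(e(X_2,Y)+e(Y,X_1)\bigr),$$ and let $\theta=\min|\theta(X_1,X_2)|$ over all such partitions. Let $X'=\{x\in X: s(x)\ge\theta\}$ (the huge vertices), $g=\sum_{x\in X\setminus X'}s(x)$, $b=\frac12\sum_{x\in X}(d(x)-s(x))$, and let $\tau$ be the number of essential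 tight components of the induced digraph $D[Y]$. Let $\varepsilon>0$ and assume that $d(y)\le \varepsilon^2m/4$ for every $y\in Y$. Suppose that $|X'|=3$. Then either there is a partition $V_1,V_2$ of $V(D)$ with $$\min\{e(V_1,V_2),e(V_2,V_1)\}\ge\Bigl(\frac{3}{14}-\varepsilon\Bigr)m,$$ or, whenever $X'=\{v_1,v_2,v_3\}$ with $s(v_1)\ge s(v_2)\ge s(v_3)$ and $\Delta_j=s(v_j)$, $$b<3\Delta_2+3\Delta_3-4\Delta_1-4g-\frac{e(Y)}{2}-\frac{7\,(|V(D)|-\tau)}{4}.$$ -/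

import Mathlib

/-- A set `B` of vertices of `G` induces a connected subgraph that has no cut vertex. -/
def SimpleGraph.IsNonseparable {W : Type*} (G : SimpleGraph W) (B : Set W) : Prop :=
  (G.induce B).Connected ∧ ∀ v ∈ B, (G.induce (B \ {v})).Preconnected

/-- The vertex set of a block: a block is a maximal connected subgraph without a cut vertex
(such a subgraph is always induced). Isolated vertices and bridges are blocks. -/
def SimpleGraph.IsBlock {W : Type*} (G : SimpleGraph W) (B : Set W) : Prop :=
  Maximal G.IsNonseparable B

/-- A connected graph is tight if all its blocks are cliques of odd order. -/
def SimpleGraph.IsTight {W : Type*} (G : SimpleGraph W) : Prop :=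
  G.Connected ∧ ∀ B : Set W, G.IsBlock B → G.IsClique B ∧ Odd B.ncard

namespace Digraph

/-- The subdigraph `D[S]` induced by `S`. -/
def inducedOn {V : Type*} (D : Digraph V) (S : Finset V) : Digraph S where
  Adj u v := D.Adj u v

/-- A set `T` of vertices of `D` is the vertex set of an essential tight component: a connected
component of the underlying graph that is tight, and on which `D` has no two parallel arcs in
opposite directions. -/
def IsEssentialTight {V : Type*} (D : Digraph V)
    (T : D.toSimpleGraphInclusive.ConnectedComponent) : Prop :=
  T.toSimpleGraph.IsTight ∧ ∀ u ∈ T.supp, ∀ v ∈ T.supp, ¬ (D.Adj u v ∧ D.Adj v u)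

/-- The number of essential tight components of `D`. -/
noncomputable def essentialTightCount {V : Type*} (D : Digraph V) : ℕ :=
  {T : D.toSimpleGraphInclusive.ConnectedComponent | D.IsEssentialTight T}.ncard

open Classical in
/-- `e(A, B)`: the number of arcs directed from `A` to `B`. -/
noncomputable def e {V : Type*} (D : Digraph V) (A B : Finset V) : ℕ :=
  ((A ×ˢ B).filter fun p => D.Adj p.1 p.2).card

/-- The number of arcs of `D`. -/
noncomputable def arcCount {V : Type*} [Fintype V] (D : Digraph V) : ℕ :=
  D.e Finset.univ Finset.univ

open Classical in
/-- The outdegree of `x`. -/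
noncomputable def outdeg {V : Type*} [Fintype V] (D : Digraph V) (x : V) : ℕ :=
  (Finset.univ.filter fun y => D.Adj x y).card

open Classical in
/-- The indegree of `x`. -/
noncomputable def indeg {V : Type*} [Fintype V] (D : Digraph V) (x : V) : ℕ :=
  (Finset.univ.filter fun y => D.Adj y x).card

/-- The degree `d(x)`: outdegree plus indegree. -/
noncomputable def deg {V : Type*} [Fintype V] (D : Digraph V) (x : V) : ℕ :=
  D.outdeg x + D.indeg x

/-- `s(x)`: the larger of `outdegree - indegree` and `indegree - outdegree`. -/
noncomputable def s {V : Type*} [Fintype V] (D : Digraph V) (x : V) : ℤ :=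
  max ((D.outdeg x : ℤ) - D.indeg x) ((D.indeg x : ℤ) - D.outdeg x)

/-- The gap `θ(X₁, X₂)` of a partition of `X`, with `Y` the complement of `X`. -/
noncomputable def gap {V : Type*} (D : Digraph V) (Y X₁ X₂ : Finset V) : ℤ :=
  ((D.e X₁ Y : ℤ) + D.e Y X₂) - ((D.e X₂ Y : ℤ) + D.e Y X₁)

/-- `θ`: the minimum of `|θ(X₁, X₂)|` over all partitions `X₁, X₂` of `X` (a part may be empty). -/
noncomputable def minGap {V : Type*} [DecidableEq V] (D : Digraph V) (X Y : Finset V) : ℤ :=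
  X.powerset.inf' (Finset.powerset_nonempty X) fun X₁ => |D.gap Y X₁ (X \ X₁)|

/-- The set `X'` of huge vertices in `X`, those with `s(x) ≥ θ`. -/
noncomputable def huge {V : Type*} [Fintype V] [DecidableEq V] (D : Digraph V)
    (X Y : Finset V) : Finset V :=
  X.filter fun x => D.minGap X Y ≤ D.s x

/-- `g`: the sum of `s(x)` over the vertices of `X` that are not huge. -/
noncomputable def gSum {V : Type*} [Fintype V] [DecidableEq V] (D : Digraph V)
    (X Y : Finset V) : ℤ :=
  ∑ x ∈ X \ D.huge X Y, D.s x

/-- `b`, defined by `2b = ∑ x ∈ X, (d(x) - s(x))`. -/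
noncomputable def bHalf {V : Type*} [Fintype V] (D : Digraph V) (X : Finset V) : ℝ :=
  (∑ x ∈ X, ((D.deg x : ℝ) - (D.s x : ℝ))) / 2

end Digraph

/-! The first alternative always holds. Place the vertices of `X` deterministically and each vertex
of `Y` in `V₁` independently with probability `p`. Since `X` spans no arcs and degrees in `Y` are
small, both cut sizes can be kept within `ε * m` of their expectations
(`exists_partition_of_sides`), so it suffices to make both expectations at least `3m/14`.

If `θ ≤ m/7`, take `p = 1/2` and a partition of `X` attaining `θ`: both expectations are at least
`m/4 - θ/4 ≥ 3m/14`.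

If `θ > m/7`, the non-huge vertices are too light to carry a signed sum across the window `(-θ, θ)`.
Hence for each huge vertex the imbalances of the other two exceed its own by at least `θ + g`
(`minGap_add_gSum_le`). With `p = 5/8`, arcs inside `Y` count `15/64 > 3/14`. Minimum outdegree 4
gives `4|Y| ≤ e(Y) + e(Y, X)`, which rules out three huge vertices with more out-arcs than in-arcs.
In every other orientation pattern, one of three placements of `X` works, by linear arithmetic
(`exists_sides`). -/

/-! ### Linear inequalities for placing three huge vertices. -/

/-- Expected number of arcs from `V₁` to `V₂` contributed by a vertex `x` with `a` arcs to and `b`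
arcs from a random set `Y`, each of whose elements lies in `V₁` with probability `5 / 8`; here `x`
lies in `V₁` if and only if `c` is true. -/
noncomputable def sideWeight (c : Bool) (a b : ℝ) : ℝ := if c then 3 / 8 * a else 5 / 8 * b

/-- All three vertices are in-heavy. Each candidate puts two of them in `V₁` and one in `V₂`. The
first candidate to meet the `V₁ → V₂` target also meets the reverse one, and the three cannot all
miss it. -/
theorem exists_sides_iii {N E O I g o₁ i₁ o₂ i₂ o₃ i₃ : ℝ} (hN : 0 < N) (hE : 0 ≤ E)
    (hO : 0 ≤ O) (hg₁ : O - I ≤ g) (hg₂ : I - O ≤ g)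
    (ho₁ : 0 ≤ o₁) (ho₂ : 0 ≤ o₂) (ho₃ : 0 ≤ o₃) (hi₁ : i₁ ≤ N)
    (hout : 4 * N ≤ E + (i₁ + i₂ + i₃ + I))
    {m : ℝ} (hm : m = E + (o₁ + i₁ + (o₂ + i₂) + (o₃ + i₃) + (O + I)))
    (gap₁ : m + 7 * g + 7 * (i₁ - o₁) ≤ 7 * (i₂ - o₂) + 7 * (i₃ - o₃))
    (gap₂ : m + 7 * g + 7 * (i₂ - o₂) ≤ 7 * (i₁ - o₁) + 7 * (i₃ - o₃))
    (gap₃ : m + 7 * g + 7 * (i₃ - o₃) ≤ 7 * (i₁ - o₁) + 7 * (i₂ - o₂)) :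
    ∃ c₁ c₂ c₃ c : Bool,
      3 / 14 * m ≤ 15 / 64 * E + (sideWeight c₁ o₁ i₁ + sideWeight c₂ o₂ i₂ + sideWeight c₃ o₃ i₃
        + sideWeight c O I) ∧
      3 / 14 * m ≤ 15 / 64 * E + (sideWeight c₁ i₁ o₁ + sideWeight c₂ i₂ o₂ + sideWeight c₃ i₃ o₃
        + sideWeight c I O) := by
  by_contra! H
  have H₁ := H true true false true
  have H₂ := H true false true false
  have H₃ := H false true true true
  simp only [sideWeight, if_true, Bool.false_eq_true, if_false] at H₁ H₂ H₃
  rcases le_or_gt (3 / 14 * m) (15 / 64 * E + (3 / 8 * o₁ + 3 / 8 * o₂ + 5 / 8 * i₃ + 3 / 8 * O))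
    with k₁ | k₁
  · have := H₁ k₁
    linarith
  rcases le_or_gt (3 / 14 * m) (15 / 64 * E + (3 / 8 * o₁ + 5 / 8 * i₂ + 3 / 8 * o₃ + 5 / 8 * I))
    with k₂ | k₂
  · have := H₂ k₂
    linarith
  rcases le_or_gt (3 / 14 * m) (15 / 64 * E + (5 / 8 * i₁ + 3 / 8 * o₂ + 3 / 8 * o₃ + 3 / 8 * O))
    with k₃ | k₃
  · have := H₃ k₃
    linarith
  linarith

/-- Two in-heavy vertices and one out-heavy. The candidates put the out-heavy vertex and one
in-heavy vertex in `V₂`. As in the all-in-heavy case, only the `V₁ → V₂` target is critical, and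
some candidate meets it. -/
theorem exists_sides_iio {N E O I g o₁ i₁ o₂ i₂ o₃ i₃ : ℝ} (hN : 0 < N) (hE : 0 ≤ E)
    (hO : 0 ≤ O) (hg₁ : O - I ≤ g) (hg₂ : I - O ≤ g)
    (ho₁ : 0 ≤ o₁) (ho₂ : 0 ≤ o₂) (hi₃ : 0 ≤ i₃) (hi₁ : i₁ ≤ N) (hi₂ : i₂ ≤ N) (ho₃ : o₃ ≤ N)
    (h₃ : i₃ ≤ o₃) (hout : 4 * N ≤ E + (i₁ + i₂ + i₃ + I))
    {m : ℝ} (hm : m = E + (o₁ + i₁ + (o₂ + i₂) + (o₃ + i₃) + (O + I)))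
    (gap₁ : m + 7 * g + 7 * (i₁ - o₁) ≤ 7 * (i₂ - o₂) + 7 * (o₃ - i₃))
    (gap₂ : m + 7 * g + 7 * (i₂ - o₂) ≤ 7 * (i₁ - o₁) + 7 * (o₃ - i₃))
    (gap₃ : m + 7 * g + 7 * (o₃ - i₃) ≤ 7 * (i₁ - o₁) + 7 * (i₂ - o₂)) :
    ∃ c₁ c₂ c₃ c : Bool,
      3 / 14 * m ≤ 15 / 64 * E + (sideWeight c₁ o₁ i₁ + sideWeight c₂ o₂ i₂ + sideWeight c₃ o₃ i₃
        + sideWeight c O I) ∧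
      3 / 14 * m ≤ 15 / 64 * E + (sideWeight c₁ i₁ o₁ + sideWeight c₂ i₂ o₂ + sideWeight c₃ i₃ o₃
        + sideWeight c I O) := by
  by_contra! H
  have H₁ := H true false false true
  have H₂ := H true false false false
  have H₃ := H false true false true
  simp only [sideWeight, if_true, Bool.false_eq_true, if_false] at H₁ H₂ H₃
  rcases le_or_gt (3 / 14 * m) (15 / 64 * E + (3 / 8 * o₁ + 5 / 8 * i₂ + 5 / 8 * i₃ + 3 / 8 * O))
    with k₁ | k₁
  · have := H₁ k₁
    linarith
  rcases le_or_gt (3 / 14 * m) (15 / 64 * E + (3 / 8 * o₁ + 5 / 8 * i₂ + 5 / 8 * i₃ + 5 / 8 * I))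
    with k₂ | k₂
  · have := H₂ k₂
    linarith
  rcases le_or_gt (3 / 14 * m) (15 / 64 * E + (5 / 8 * i₁ + 3 / 8 * o₂ + 5 / 8 * i₃ + 3 / 8 * O))
    with k₃ | k₃
  · have := H₃ k₃
    linarith
  linarith

/-- One in-heavy vertex and two out-heavy. The candidates put the in-heavy vertex and one out-heavy
vertex in `V₂`. Now the critical direction is `V₂ → V₁`: if no candidate worked, all three would
meet the `V₁ → V₂` target and miss the reverse one, which is inconsistent. -/
theorem exists_sides_ioo {N E O I g o₁ i₁ o₂ i₂ o₃ i₃ : ℝ} (hN : 0 < N)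
    (hO : 0 ≤ O) (hI : 0 ≤ I) (hg₁ : O - I ≤ g) (hg₂ : I - O ≤ g)
    (ho₁ : 0 ≤ o₁) (hi₂ : 0 ≤ i₂) (hi₃ : 0 ≤ i₃) (hi₁ : i₁ ≤ N) (ho₂ : o₂ ≤ N) (ho₃ : o₃ ≤ N)
    (hout : 4 * N ≤ E + (i₁ + i₂ + i₃ + I))
    {m : ℝ} (hm : m = E + (o₁ + i₁ + (o₂ + i₂) + (o₃ + i₃) + (O + I)))
    (gap₁ : m + 7 * g + 7 * (i₁ - o₁) ≤ 7 * (o₂ - i₂) + 7 * (o₃ - i₃))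
    (gap₂ : m + 7 * g + 7 * (o₂ - i₂) ≤ 7 * (i₁ - o₁) + 7 * (o₃ - i₃))
    (gap₃ : m + 7 * g + 7 * (o₃ - i₃) ≤ 7 * (i₁ - o₁) + 7 * (o₂ - i₂)) :
    ∃ c₁ c₂ c₃ c : Bool,
      3 / 14 * m ≤ 15 / 64 * E + (sideWeight c₁ o₁ i₁ + sideWeight c₂ o₂ i₂ + sideWeight c₃ o₃ i₃
        + sideWeight c O I) ∧
      3 / 14 * m ≤ 15 / 64 * E + (sideWeight c₁ i₁ o₁ + sideWeight c₂ i₂ o₂ + sideWeight c₃ i₃ o₃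
        + sideWeight c I O) := by
  by_contra! H
  have H₁ := H false true false true
  have H₂ := H false true false false
  have H₃ := H false false true true
  simp only [sideWeight, if_true, Bool.false_eq_true, if_false] at H₁ H₂ H₃
  rcases le_or_gt (3 / 14 * m) (15 / 64 * E + (5 / 8 * i₁ + 3 / 8 * o₂ + 5 / 8 * i₃ + 3 / 8 * O))
    with k₁ | k₁
  · have := H₁ k₁
    rcases le_or_gt (3 / 14 * m) (15 / 64 * E + (5 / 8 * i₁ + 3 / 8 * o₂ + 5 / 8 * i₃ + 5 / 8 * I))
      with k₂ | k₂
    · have := H₂ k₂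
      rcases le_or_gt (3 / 14 * m)
        (15 / 64 * E + (5 / 8 * i₁ + 5 / 8 * i₂ + 3 / 8 * o₃ + 3 / 8 * O)) with k₃ | k₃
      · have := H₃ k₃
        linarith
      · linarith
    · linarith
  · linarith

/-- The linear inequalities behind the choice of sides for three vertices of large imbalance
`|o - i|`, all other vertices of `X` (with `O` arcs to and `I` arcs from `Y`) being kept
together. -/
theorem exists_sides {N E O I g o₁ i₁ o₂ i₂ o₃ i₃ : ℝ} (hN : 0 < N) (hE : 0 ≤ E)
    (hO : 0 ≤ O) (hI : 0 ≤ I) (hg₁ : |O - I| ≤ g)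
    (ho₁ : 0 ≤ o₁) (ho₂ : 0 ≤ o₂) (ho₃ : 0 ≤ o₃) (hi₁ : 0 ≤ i₁) (hi₂ : 0 ≤ i₂) (hi₃ : 0 ≤ i₃)
    (ko₁ : o₁ ≤ N) (ko₂ : o₂ ≤ N) (ko₃ : o₃ ≤ N) (ki₁ : i₁ ≤ N) (ki₂ : i₂ ≤ N) (ki₃ : i₃ ≤ N)
    (hout : 4 * N ≤ E + (i₁ + i₂ + i₃ + I))
    {m : ℝ} (hm : m = E + (o₁ + i₁ + (o₂ + i₂) + (o₃ + i₃) + (O + I)))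
    (gap₁ : m + 7 * g + 7 * |o₁ - i₁| < 7 * |o₂ - i₂| + 7 * |o₃ - i₃|)
    (gap₂ : m + 7 * g + 7 * |o₂ - i₂| < 7 * |o₁ - i₁| + 7 * |o₃ - i₃|)
    (gap₃ : m + 7 * g + 7 * |o₃ - i₃| < 7 * |o₁ - i₁| + 7 * |o₂ - i₂|) :
    ∃ c₁ c₂ c₃ c : Bool,
      3 / 14 * m ≤ 15 / 64 * E + (sideWeight c₁ o₁ i₁ + sideWeight c₂ o₂ i₂ + sideWeight c₃ o₃ i₃
        + sideWeight c O I) ∧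
      3 / 14 * m ≤ 15 / 64 * E + (sideWeight c₁ i₁ o₁ + sideWeight c₂ i₂ o₂ + sideWeight c₃ i₃ o₃
        + sideWeight c I O) := by
  obtain ⟨hg₃, hg₄⟩ := abs_le.1 hg₁
  have hg₅ : I - O ≤ g := by linarith
  -- The eight orientation patterns reduce to four by permuting the three vertices.
  rcases le_total o₁ i₁ with h₁ | h₁ <;> rcases le_total o₂ i₂ with h₂ | h₂ <;>
    rcases le_total o₃ i₃ with h₃ | h₃ <;>
    simp only [abs_of_nonneg (sub_nonneg.2 h₁), abs_of_nonneg (sub_nonneg.2 h₂),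
      abs_of_nonneg (sub_nonneg.2 h₃), abs_of_nonpos (sub_nonpos.2 h₁),
      abs_of_nonpos (sub_nonpos.2 h₂), abs_of_nonpos (sub_nonpos.2 h₃), neg_sub]
      at gap₁ gap₂ gap₃
  · exact exists_sides_iii hN hE hO hg₄ hg₅ ho₁ ho₂ ho₃ ki₁ hout hm gap₁.le gap₂.le gap₃.le
  · exact exists_sides_iio hN hE hO hg₄ hg₅ ho₁ ho₂ hi₃ ki₁ ki₂ ko₃ h₃ hout hm gap₁.le gap₂.le gap₃.le
  · obtain ⟨c₁, c₃, c₂, c, hA, hB⟩ := exists_sides_iio (E := E) (m := m) hN hE hO hg₄ hg₅ ho₁ ho₃ hi₂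
      ki₁ ki₃ ko₂ h₂ (by linarith) (by linarith) (by linarith) (by linarith) (by linarith)
    exact ⟨c₁, c₂, c₃, c, by linarith, by linarith⟩
  · exact exists_sides_ioo hN hO hI hg₄ hg₅ ho₁ hi₂ hi₃ ki₁ ko₂ ko₃ hout hm gap₁.le gap₂.le gap₃.le
  · obtain ⟨c₃, c₂, c₁, c, hA, hB⟩ := exists_sides_iio (E := E) (m := m) hN hE hO hg₄ hg₅ ho₃ ho₂ hi₁
      ki₃ ki₂ ko₁ h₁ (by linarith) (by linarith) (by linarith) (by linarith) (by linarith)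
    exact ⟨c₁, c₂, c₃, c, by linarith, by linarith⟩
  · obtain ⟨c₂, c₁, c₃, c, hA, hB⟩ := exists_sides_ioo (E := E) (m := m) hN hO hI hg₄ hg₅ ho₂ hi₁ hi₃
      ki₂ ko₁ ko₃ (by linarith) (by linarith) (by linarith) (by linarith) (by linarith)
    exact ⟨c₁, c₂, c₃, c, by linarith, by linarith⟩
  · obtain ⟨c₃, c₂, c₁, c, hA, hB⟩ := exists_sides_ioo (E := E) (m := m) hN hO hI hg₄ hg₅ ho₃ hi₂ hi₁
      ki₃ ko₂ ko₁ (by linarith) (by linarith) (by linarith) (by linarith) (by linarith)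
    exact ⟨c₁, c₂, c₃, c, by linarith, by linarith⟩
  -- Three out-heavy vertices: adding the gaps gives `∑ (o - i) > 3m/7`, whereas `m ≥ 4N + ∑ o` and
  -- `∑ o ≤ 3N` give `∑ o ≤ 3m/7`. Strictness of the gaps matters here.
  · exfalso
    linarith

/-! ### Fractional cuts and their rounding. -/

namespace Digraph

open Classical in
/-- The indicator of an arc from `u` to `v`. -/
noncomputable def arcInd {V : Type*} (D : Digraph V) (u v : V) : ℝ := if D.Adj u v then 1 else 0

theorem arcInd_nonneg {V : Type*} (D : Digraph V) (u v : V) : 0 ≤ D.arcInd u v := by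
  unfold arcInd
  split_ifs <;> norm_num

theorem arcInd_self {V : Type*} {D : Digraph V} (hloop : ∀ v, ¬ D.Adj v v) (v : V) :
    D.arcInd v v = 0 := by
  simp [arcInd, hloop v]

theorem e_eq_sum {V : Type*} (D : Digraph V) (A B : Finset V) :
    (D.e A B : ℝ) = ∑ u ∈ A, ∑ v ∈ B, D.arcInd u v := by
  classical
  unfold e arcInd
  rw [Finset.card_filter, Finset.sum_product]
  push_cast
  refine Finset.sum_congr rfl fun u _ => Finset.sum_congr rfl fun v _ => ?_
  congr

theorem arcInd_eq_zero_of_e_eq_zero {V : Type*} {D : Digraph V} {A B : Finset V}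
    (h : D.e A B = 0) {u v : V} (hu : u ∈ A) (hv : v ∈ B) : D.arcInd u v = 0 := by
  classical
  have h' : (∑ u ∈ A, ∑ v ∈ B, D.arcInd u v) = 0 := by rw [← e_eq_sum, h, Nat.cast_zero]
  have h₁ := (Finset.sum_eq_zero_iff_of_nonneg fun u _ =>
    Finset.sum_nonneg fun v _ => D.arcInd_nonneg u v).1 h' u hu
  exact (Finset.sum_eq_zero_iff_of_nonneg fun v _ => D.arcInd_nonneg u v).1 h₁ v hv

section Fintype

variable {V : Type*} [Fintype V] (D : Digraph V)

theorem outdeg_eq_sum (x : V) : (D.outdeg x : ℝ) = ∑ v, D.arcInd x v := by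
  classical
  unfold outdeg arcInd
  rw [Finset.card_filter]
  push_cast
  refine Finset.sum_congr rfl fun v _ => ?_
  congr

theorem indeg_eq_sum (x : V) : (D.indeg x : ℝ) = ∑ u, D.arcInd u x := by
  classical
  unfold indeg arcInd
  rw [Finset.card_filter]
  push_cast
  refine Finset.sum_congr rfl fun v _ => ?_
  congr

theorem arcCount_eq_sum : (D.arcCount : ℝ) = ∑ u, ∑ v, D.arcInd u v :=
  D.e_eq_sum _ _

theorem sum_deg : ∑ x, (D.deg x : ℝ) = 2 * D.arcCount := by
  simp only [deg, Nat.cast_add, Finset.sum_add_distrib, outdeg_eq_sum, indeg_eq_sum,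
    arcCount_eq_sum]
  rw [Finset.sum_comm (f := fun x u => D.arcInd u x)]
  ring

theorem s_eq_abs (x : V) : D.s x = |(D.outdeg x : ℤ) - D.indeg x| := by
  rw [s, abs_eq_max_neg, neg_sub]

/-- The multilinear extension of the number of arcs leaving a vertex set. -/
noncomputable def fracCut (z : V → ℝ) : ℝ := ∑ u, ∑ v, D.arcInd u v * (z u * (1 - z v))

/-- The partial derivative of `fracCut` in the direction of `y`. -/
noncomputable def cutSlope (z : V → ℝ) (y : V) : ℝ :=
  ∑ v, D.arcInd y v * (1 - z v) - ∑ u, D.arcInd u y * z u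

theorem abs_cutSlope_le {z : V → ℝ} (h₀ : ∀ v, 0 ≤ z v) (h₁ : ∀ v, z v ≤ 1) (y : V) :
    |D.cutSlope z y| ≤ D.deg y := by
  have ha : 0 ≤ ∑ v, D.arcInd y v * (1 - z v) :=
    Finset.sum_nonneg fun v _ => mul_nonneg (D.arcInd_nonneg _ _) (by linarith [h₁ v])
  have hb : 0 ≤ ∑ u, D.arcInd u y * z u :=
    Finset.sum_nonneg fun v _ => mul_nonneg (D.arcInd_nonneg _ _) (h₀ v)
  have ha' : ∑ v, D.arcInd y v * (1 - z v) ≤ D.outdeg y := by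
    rw [outdeg_eq_sum]
    exact Finset.sum_le_sum fun v _ =>
      mul_le_of_le_one_right (D.arcInd_nonneg _ _) (by linarith [h₀ v])
  have hb' : ∑ u, D.arcInd u y * z u ≤ D.indeg y := by
    rw [indeg_eq_sum]
    exact Finset.sum_le_sum fun v _ => mul_le_of_le_one_right (D.arcInd_nonneg _ _) (h₁ v)
  have : (D.deg y : ℝ) = D.outdeg y + D.indeg y := by simp [deg]
  rw [abs_le, cutSlope, this]
  constructor <;> linarith

/-- Without loops no term contains a coordinate twice, so the extension is affine in each
coordinate. -/
theorem fracCut_update [DecidableEq V] {D : Digraph V} (hloop : ∀ v, ¬ D.Adj v v) (z : V → ℝ)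
    (y : V) (t : ℝ) :
    D.fracCut (Function.update z y t) = D.fracCut z + (t - z y) * D.cutSlope z y := by
  have key : ∀ u v, D.arcInd u v * (Function.update z y t u * (1 - Function.update z y t v)) =
      D.arcInd u v * (z u * (1 - z v)) +
        ((if u = y then (t - z y) * (D.arcInd y v * (1 - z v)) else 0) -
          (if v = y then (t - z y) * (D.arcInd u y * z u) else 0)) := by
    intro u v
    by_cases hu : u = y <;> by_cases hv : v = y
    · subst hu; subst hv
      simp [arcInd_self hloop]
    · subst hu
      simp [hv]; ring
    · subst hv
      simp [hu]; ring
    · simp [hu, hv]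
  unfold fracCut cutSlope
  simp_rw [key, Finset.sum_add_distrib, Finset.sum_sub_distrib]
  congr 1
  rw [mul_sub, Finset.mul_sum, Finset.mul_sum]
  congr 1
  · rw [Finset.sum_comm]
    simp
  · simp

/-- Rounding one coordinate of an affine pair does not increase the squared distance to the
origin by much. -/
theorem exists_round {ζ α β s r M : ℝ} (h₀ : 0 ≤ ζ) (h₁ : ζ ≤ 1) (hs : |s| ≤ M) (hr : |r| ≤ M) :
    ∃ t : ℝ, (t = 0 ∨ t = 1) ∧
      (α + (t - ζ) * s) ^ 2 + (β + (t - ζ) * r) ^ 2 ≤ α ^ 2 + β ^ 2 + M ^ 2 / 2 := by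
  by_contra! H
  have H0 := H 0 (Or.inl rfl)
  have H1 := H 1 (Or.inr rfl)
  have hs' : s ^ 2 ≤ M ^ 2 := sq_le_sq' (abs_le.1 hs).1 (abs_le.1 hs).2
  have hr' : r ^ 2 ≤ M ^ 2 := sq_le_sq' (abs_le.1 hr).1 (abs_le.1 hr).2
  have hz : ζ * (1 - ζ) ≤ 1 / 4 := by nlinarith [sq_nonneg (ζ - 1 / 2)]
  have hz0 : 0 ≤ ζ * (1 - ζ) := mul_nonneg h₀ (by linarith)
  have hm : ζ * (1 - ζ) * (s ^ 2 + r ^ 2) ≤ 1 / 4 * (2 * M ^ 2) :=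
    mul_le_mul hz (by linarith) (by positivity) (by norm_num)
  -- For random `t ∈ {0, 1}` with mean `ζ`, the expected squared distance grows exactly by the
  -- variance, at most `M² / 2`; some outcome does no worse than the average.
  have hid : ζ * ((α + (1 - ζ) * s) ^ 2 + (β + (1 - ζ) * r) ^ 2) +
      (1 - ζ) * ((α + (0 - ζ) * s) ^ 2 + (β + (0 - ζ) * r) ^ 2) =
      α ^ 2 + β ^ 2 + ζ * (1 - ζ) * (s ^ 2 + r ^ 2) := by ring
  -- At `ζ = 0` the choice `t = 0` changes nothing; otherwise the strict bound at `t = 1` has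
  -- positive weight.
  rcases h₀.eq_or_lt with h | h
  · subst h
    norm_num at H0
    nlinarith [sq_nonneg M]
  · have e1 := mul_lt_mul_of_pos_left H1 h
    have e2 := mul_le_mul_of_nonneg_left H0.le (sub_nonneg.2 h₁)
    linarith

/-- A derandomised second-moment argument: coordinates are rounded one at a time, controlling both
cut directions together. The slopes of the two directions are each bounded by the degree of the
rounded vertex. -/
theorem exists_rounding [DecidableEq V] {D : Digraph V} (hloop : ∀ v, ¬ D.Adj v v) (a b : ℝ)
    (T : Finset V) {z : V → ℝ} (h₀ : ∀ v, 0 ≤ z v) (h₁ : ∀ v, z v ≤ 1) :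
    ∃ w : V → ℝ, (∀ v, 0 ≤ w v) ∧ (∀ v, w v ≤ 1) ∧ (∀ v ∈ T, w v = 0 ∨ w v = 1) ∧
      (∀ v ∉ T, w v = z v) ∧
      (D.fracCut w - a) ^ 2 + (D.fracCut (fun v => 1 - w v) - b) ^ 2 ≤
        (D.fracCut z - a) ^ 2 + (D.fracCut (fun v => 1 - z v) - b) ^ 2 +
          ∑ y ∈ T, (D.deg y : ℝ) ^ 2 / 2 := by
  induction T using Finset.induction_on with
  | empty => exact ⟨z, h₀, h₁, by simp, by simp, by simp⟩
  | insert y T hy ih =>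
    obtain ⟨w, w₀, w₁, wT, wz, hw⟩ := ih
    have hs := D.abs_cutSlope_le w₀ w₁ y
    have hr : |-D.cutSlope (fun v => 1 - w v) y| ≤ D.deg y := by
      rw [abs_neg]
      exact D.abs_cutSlope_le (fun v => by linarith [w₁ v]) (fun v => by linarith [w₀ v]) y
    obtain ⟨t, ht, h⟩ := exists_round (α := D.fracCut w - a)
      (β := D.fracCut (fun v => 1 - w v) - b) (w₀ y) (w₁ y) hs hr
    have hc : (fun v => 1 - Function.update w y t v) =
        Function.update (fun v => 1 - w v) y (1 - t) := by
      ext v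
      by_cases hv : v = y <;> simp [hv]
    refine ⟨Function.update w y t, fun v => ?_, fun v => ?_, fun v hv => ?_, fun v hv => ?_, ?_⟩
    · by_cases hv : v = y
      · rcases ht with rfl | rfl <;> simp [hv]
      · simpa [Function.update_apply, hv] using w₀ v
    · by_cases hv : v = y
      · rcases ht with rfl | rfl <;> simp [hv]
      · simpa [Function.update_apply, hv] using w₁ v
    · by_cases hvy : v = y
      · simpa [hvy] using ht
      · simpa [Function.update_apply, hvy] using wT v ((Finset.mem_insert.1 hv).resolve_left hvy)
    · rw [Finset.mem_insert, not_or] at hv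
      simpa [Function.update_apply, hv.1] using wz v hv.2
    · rw [hc, fracCut_update hloop, fracCut_update hloop, Finset.sum_insert hy]
      have e : (1 - t - (1 - w y)) * D.cutSlope (fun v => 1 - w v) y =
          (t - w y) * -D.cutSlope (fun v => 1 - w v) y := by ring
      rw [e, add_sub_right_comm, add_sub_right_comm]
      linarith

theorem fracCut_eq_e [DecidableEq V] {z : V → ℝ} (hz : ∀ v, z v = 0 ∨ z v = 1) :
    D.fracCut z =
      D.e (Finset.univ.filter fun v => z v = 1) (Finset.univ.filter fun v => z v = 0) := by
  rw [e_eq_sum, fracCut, Finset.sum_filter]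
  refine Finset.sum_congr rfl fun u _ => ?_
  rcases hz u with hu | hu
  · simp [hu]
  · rw [if_pos hu, Finset.sum_filter]
    refine Finset.sum_congr rfl fun v _ => ?_
    rcases hz v with hv | hv <;> simp [hu, hv]

/-- A fractional vertex partition that is integral outside a set of vertices of small degree can be
rounded at a small cost. -/
theorem exists_partition_of_fracCut [DecidableEq V] {D : Digraph V} (hloop : ∀ v, ¬ D.Adj v v)
    {Y : Finset V} {ε : ℝ} (hε : 0 < ε)
    (hY : ∀ y ∈ Y, (D.deg y : ℝ) ≤ ε ^ 2 * (D.arcCount : ℝ) / 4) {z : V → ℝ}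
    (h₀ : ∀ v, 0 ≤ z v) (h₁ : ∀ v, z v ≤ 1) (hz : ∀ v ∉ Y, z v = 0 ∨ z v = 1) :
    ∃ V₁ V₂ : Finset V, Disjoint V₁ V₂ ∧ V₁ ∪ V₂ = Finset.univ ∧
      D.fracCut z - ε * D.arcCount ≤ D.e V₁ V₂ ∧
      D.fracCut (fun v => 1 - z v) - ε * D.arcCount ≤ D.e V₂ V₁ := by
  obtain ⟨w, -, -, wY, wz, hw⟩ := exists_rounding hloop (D.fracCut z)
    (D.fracCut fun v => 1 - z v) Y h₀ h₁
  have wI : ∀ v, w v = 0 ∨ w v = 1 := fun v => by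
    by_cases hv : v ∈ Y
    · exact wY v hv
    · rw [wz v hv]
      exact hz v hv
  have hm : (0 : ℝ) ≤ D.arcCount := Nat.cast_nonneg _
  -- The targets are the values at `z`, so the initial deviation is zero. From `deg y ≤ ε²m/4` and
  -- `∑ deg y ≤ 2m`, the accumulated error is at most `ε²m²/4`.
  have hsum : ∑ y ∈ Y, (D.deg y : ℝ) ^ 2 / 2 ≤ (ε * D.arcCount) ^ 2 := by
    have h1 : ∑ y ∈ Y, (D.deg y : ℝ) ^ 2 / 2 ≤
        ∑ y ∈ Y, ε ^ 2 * (D.arcCount : ℝ) / 8 * (D.deg y : ℝ) :=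
      Finset.sum_le_sum fun y hy => by
        have := mul_le_mul_of_nonneg_right (hY y hy) (Nat.cast_nonneg (D.deg y) : (0 : ℝ) ≤ _)
        nlinarith
    have h2 : ∑ y ∈ Y, (D.deg y : ℝ) ≤ 2 * D.arcCount := by
      rw [← sum_deg]
      exact Finset.sum_le_sum_of_subset_of_nonneg (Finset.subset_univ _) fun _ _ _ =>
        Nat.cast_nonneg _
    rw [← Finset.mul_sum] at h1
    have h3 := mul_le_mul_of_nonneg_left h2
      (show (0 : ℝ) ≤ ε ^ 2 * (D.arcCount : ℝ) / 8 by positivity)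
    nlinarith [sq_nonneg (ε * D.arcCount)]
  have hpos : 0 ≤ ε * D.arcCount := mul_nonneg hε.le hm
  simp only [sub_self] at hw
  have hA := abs_le_of_sq_le_sq (a := D.fracCut w - D.fracCut z) (b := ε * D.arcCount)
    (by nlinarith [sq_nonneg (D.fracCut (fun v => 1 - w v) - D.fracCut fun v => 1 - z v)]) hpos
  have hB := abs_le_of_sq_le_sq (a := D.fracCut (fun v => 1 - w v) - D.fracCut fun v => 1 - z v)
    (b := ε * D.arcCount) (by nlinarith [sq_nonneg (D.fracCut w - D.fracCut z)]) hpos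
  refine ⟨Finset.univ.filter fun v => w v = 1, Finset.univ.filter fun v => w v = 0, ?_, ?_, ?_, ?_⟩
  · rw [Finset.disjoint_filter]
    intro v _ h h'
    rw [h] at h'
    norm_num at h'
  · ext v
    simpa using (wI v).symm
  · rw [← D.fracCut_eq_e wI]
    linarith [(abs_le.1 hA).1]
  · have := D.fracCut_eq_e (z := fun v => 1 - w v) fun v => by
      rcases wI v with h | h <;> simp [h]
    have e1 : (Finset.univ.filter fun v => 1 - w v = 1) = Finset.univ.filter fun v => w v = 0 :=
      Finset.filter_congr fun v _ => by constructor <;> intro h <;> linarith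
    have e2 : (Finset.univ.filter fun v => 1 - w v = 0) = Finset.univ.filter fun v => w v = 1 :=
      Finset.filter_congr fun v _ => by constructor <;> intro h <;> linarith
    rw [e1, e2] at this
    rw [← this]
    linarith [(abs_le.1 hB).1]

end Fintype

end Digraph

/-! ### Signed sums of imbalances, and cuts when `X` spans no arcs. -/

namespace Digraph

theorem arcInd_le_one {V : Type*} (D : Digraph V) (u v : V) : D.arcInd u v ≤ 1 := by
  unfold arcInd
  split_ifs <;> norm_num

/-- If no signed sum of small numbers takes `c` into the window `(-θ, θ)`, then all of these sums
have the sign of `c`. -/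
theorem add_sum_le_of_forall_le_abs {V : Type*} [DecidableEq V] {S : Finset V} {s : V → ℤ} {θ c : ℤ} (hc : 0 ≤ c)
    (hs₀ : ∀ x ∈ S, 0 ≤ s x) (hs : ∀ x ∈ S, s x < θ)
    (H : ∀ T ⊆ S, θ ≤ |c + (∑ x ∈ S, s x - 2 * ∑ x ∈ T, s x)|) : θ + ∑ x ∈ S, s x ≤ c := by
  -- Flip the signs of `T` one at a time. Each flip lowers the sum by `2 * s x < 2 * θ`, too little
  -- to jump from `≥ θ` to `≤ -θ`. Taking `T = S` gives the claim.
  have key : ∀ T : Finset V, T ⊆ S → θ ≤ c + (∑ x ∈ S, s x - 2 * ∑ x ∈ T, s x) := by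
    intro T
    induction T using Finset.induction_on with
    | empty =>
      intro hT
      have := H _ hT
      rwa [abs_of_nonneg] at this
      simpa using add_nonneg hc (Finset.sum_nonneg hs₀)
    | insert x T hx ih =>
      intro hT
      have h1 := ih fun y hy => hT (Finset.mem_insert_of_mem hy)
      have h2 := H _ hT
      have h3 := hs x (hT (Finset.mem_insert_self x T))
      rw [Finset.sum_insert hx] at h2 ⊢
      rcases le_abs.1 h2 with h | h
      · exact h
      · linarith
  have := key S subset_rfl
  linarith

variable {V : Type*} [Fintype V]

section Parts

variable [DecidableEq V] {D : Digraph V} {X Y : Finset V}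

theorem sum_univ_eq_of_parts (hdisj : Disjoint X Y) (hcover : X ∪ Y = Finset.univ) (f : V → ℝ) :
    ∑ v, f v = ∑ x ∈ X, f x + ∑ y ∈ Y, f y := by
  rw [← hcover, Finset.sum_union hdisj]

theorem outdeg_eq_sum_part (hdisj : Disjoint X Y) (hcover : X ∪ Y = Finset.univ)
    (hX : D.e X X = 0) {x : V} (hx : x ∈ X) : (D.outdeg x : ℝ) = ∑ y ∈ Y, D.arcInd x y := by
  rw [outdeg_eq_sum, sum_univ_eq_of_parts hdisj hcover,
    Finset.sum_eq_zero fun v hv => arcInd_eq_zero_of_e_eq_zero hX hx hv, zero_add]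

theorem indeg_eq_sum_part (hdisj : Disjoint X Y) (hcover : X ∪ Y = Finset.univ)
    (hX : D.e X X = 0) {x : V} (hx : x ∈ X) : (D.indeg x : ℝ) = ∑ y ∈ Y, D.arcInd y x := by
  rw [indeg_eq_sum, sum_univ_eq_of_parts hdisj hcover,
    Finset.sum_eq_zero fun v hv => arcInd_eq_zero_of_e_eq_zero hX hv hx, zero_add]

theorem outdeg_le_card_part (hdisj : Disjoint X Y) (hcover : X ∪ Y = Finset.univ)
    (hX : D.e X X = 0) {x : V} (hx : x ∈ X) : (D.outdeg x : ℝ) ≤ Y.card := by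
  rw [outdeg_eq_sum_part hdisj hcover hX hx]
  simpa using Finset.sum_le_sum fun y (_ : y ∈ Y) => D.arcInd_le_one x y

theorem indeg_le_card_part (hdisj : Disjoint X Y) (hcover : X ∪ Y = Finset.univ)
    (hX : D.e X X = 0) {x : V} (hx : x ∈ X) : (D.indeg x : ℝ) ≤ Y.card := by
  rw [indeg_eq_sum_part hdisj hcover hX hx]
  simpa using Finset.sum_le_sum fun y (_ : y ∈ Y) => D.arcInd_le_one y x

theorem arcCount_eq_of_parts (hdisj : Disjoint X Y) (hcover : X ∪ Y = Finset.univ)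
    (hX : D.e X X = 0) :
    (D.arcCount : ℝ) = D.e Y Y + ∑ x ∈ X, ((D.outdeg x : ℝ) + D.indeg x) := by
  have h₁ : ∑ x ∈ X, (D.outdeg x : ℝ) = ∑ x ∈ X, ∑ v, D.arcInd x v :=
    Finset.sum_congr rfl fun x _ => D.outdeg_eq_sum x
  have h₂ : ∑ x ∈ X, (D.indeg x : ℝ) = ∑ y ∈ Y, ∑ x ∈ X, D.arcInd y x := by
    rw [Finset.sum_comm]
    exact Finset.sum_congr rfl fun x hx => indeg_eq_sum_part hdisj hcover hX hx
  have h₃ : ∑ y ∈ Y, ∑ v, D.arcInd y v =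
      ∑ y ∈ Y, ∑ x ∈ X, D.arcInd y x + ∑ y ∈ Y, ∑ x ∈ Y, D.arcInd y x := by
    simp_rw [sum_univ_eq_of_parts hdisj hcover, Finset.sum_add_distrib]
  rw [Finset.sum_add_distrib, arcCount_eq_sum, sum_univ_eq_of_parts hdisj hcover, h₁, h₂, h₃,
    e_eq_sum]
  ring

/-- This turns the minimum outdegree into a lower bound for the arcs starting in `Y`. -/
theorem sum_outdeg_part (hdisj : Disjoint X Y) (hcover : X ∪ Y = Finset.univ)
    (hX : D.e X X = 0) :
    ∑ y ∈ Y, (D.outdeg y : ℝ) = D.e Y Y + ∑ x ∈ X, (D.indeg x : ℝ) := by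
  rw [Finset.sum_congr rfl fun x hx => indeg_eq_sum_part hdisj hcover hX hx, Finset.sum_comm,
    e_eq_sum]
  simp_rw [outdeg_eq_sum, sum_univ_eq_of_parts hdisj hcover, Finset.sum_add_distrib]
  ring

/-- With `z` left arbitrary on `X`, the same formula gives the reverse cut after replacing `z` by `1
- z` and `p` by `1 - p`. -/
theorem fracCut_of_parts (hdisj : Disjoint X Y) (hcover : X ∪ Y = Finset.univ)
    (hX : D.e X X = 0) {p : ℝ} {z : V → ℝ} (hz : ∀ y ∈ Y, z y = p) :
    D.fracCut z = p * (1 - p) * D.e Y Y +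
      ∑ x ∈ X, (z x * (1 - p) * D.outdeg x + p * (1 - z x) * D.indeg x) := by
  have hXX : ∀ x ∈ X, ∑ v, D.arcInd x v * (z x * (1 - z v)) = z x * (1 - p) * D.outdeg x := by
    intro x hx
    rw [sum_univ_eq_of_parts hdisj hcover, outdeg_eq_sum_part hdisj hcover hX hx,
      Finset.sum_eq_zero fun v hv => by rw [arcInd_eq_zero_of_e_eq_zero hX hx hv, zero_mul],
      zero_add, Finset.mul_sum]
    exact Finset.sum_congr rfl fun y hy => by rw [hz y hy]; ring
  have hYX : ∑ y ∈ Y, ∑ v ∈ X, D.arcInd y v * (z y * (1 - z v)) =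
      ∑ x ∈ X, p * (1 - z x) * D.indeg x := by
    rw [Finset.sum_comm]
    refine Finset.sum_congr rfl fun x hx => ?_
    rw [indeg_eq_sum_part hdisj hcover hX hx, Finset.mul_sum]
    exact Finset.sum_congr rfl fun y hy => by rw [hz y hy]; ring
  have hYY : ∑ y ∈ Y, ∑ v ∈ Y, D.arcInd y v * (z y * (1 - z v)) = p * (1 - p) * D.e Y Y := by
    rw [e_eq_sum, Finset.mul_sum]
    refine Finset.sum_congr rfl fun y hy => ?_
    rw [Finset.mul_sum]
    exact Finset.sum_congr rfl fun v hv => by rw [hz y hy, hz v hv]; ring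
  rw [fracCut, sum_univ_eq_of_parts hdisj hcover, Finset.sum_congr rfl hXX,
    Finset.sum_congr (s₁ := Y) rfl fun y _ => sum_univ_eq_of_parts hdisj hcover _,
    Finset.sum_add_distrib, Finset.sum_add_distrib, hYX, hYY]
  ring

/-- Placing the vertices of `Y` independently at random, with probability `p` for `V₁`. -/
theorem exists_partition_of_sides (hloop : ∀ v, ¬ D.Adj v v) (hdisj : Disjoint X Y)
    (hcover : X ∪ Y = Finset.univ) (hX : D.e X X = 0) {ε : ℝ} (hε : 0 < ε)
    (hY : ∀ y ∈ Y, (D.deg y : ℝ) ≤ ε ^ 2 * (D.arcCount : ℝ) / 4) {p : ℝ} (hp₀ : 0 ≤ p)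
    (hp₁ : p ≤ 1) (c : V → Bool) {t : ℝ}
    (hA : t ≤ p * (1 - p) * D.e Y Y +
      ∑ x ∈ X, if c x then (1 - p) * (D.outdeg x : ℝ) else p * (D.indeg x : ℝ))
    (hB : t ≤ p * (1 - p) * D.e Y Y +
      ∑ x ∈ X, if c x then (1 - p) * (D.indeg x : ℝ) else p * (D.outdeg x : ℝ)) :
    ∃ V₁ V₂ : Finset V, Disjoint V₁ V₂ ∧ V₁ ∪ V₂ = Finset.univ ∧
      t - ε * (D.arcCount : ℝ) ≤ min (D.e V₁ V₂ : ℝ) (D.e V₂ V₁ : ℝ) := by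
  set z : V → ℝ := fun v => if v ∈ Y then p else if c v then 1 else 0 with hz
  have hzY : ∀ y ∈ Y, z y = p := fun y hy => by simp [hz, hy]
  have hzX : ∀ x ∉ Y, z x = if c x then 1 else 0 := fun x hx => by simp [hz, hx]
  have hzc : ∀ x ∉ Y, z x = 0 ∨ z x = 1 := fun x hx => by
    rw [hzX x hx]
    split_ifs <;> simp
  have h₀ : ∀ v, 0 ≤ z v := fun v => by
    by_cases hv : v ∈ Y
    · rw [hzY v hv]; exact hp₀
    · rcases hzc v hv with h | h <;> rw [h]; norm_num
  have h₁ : ∀ v, z v ≤ 1 := fun v => by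
    by_cases hv : v ∈ Y
    · rw [hzY v hv]; exact hp₁
    · rcases hzc v hv with h | h <;> rw [h]; norm_num
  obtain ⟨V₁, V₂, hd, hu, hA', hB'⟩ := exists_partition_of_fracCut hloop hε hY h₀ h₁ hzc
  rw [fracCut_of_parts hdisj hcover hX hzY] at hA'
  rw [fracCut_of_parts hdisj hcover hX (p := 1 - p) fun y hy => by rw [hzY y hy]] at hB'
  refine ⟨V₁, V₂, hd, hu, le_min ((sub_le_sub_right (hA.trans_eq ?_) _).trans hA')
    ((sub_le_sub_right (hB.trans_eq ?_) _).trans hB')⟩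
  · congr 1
    refine Finset.sum_congr rfl fun x hx => ?_
    rw [hzX x (Finset.disjoint_left.1 hdisj hx)]
    split_ifs <;> ring
  · congr 1
    · ring
    · refine Finset.sum_congr rfl fun x hx => ?_
      rw [hzX x (Finset.disjoint_left.1 hdisj hx)]
      split_ifs <;> ring

theorem gap_eq_sum (hdisj : Disjoint X Y) (hcover : X ∪ Y = Finset.univ) (hX : D.e X X = 0)
    {X₁ : Finset V} (h : X₁ ⊆ X) :
    D.gap Y X₁ (X \ X₁) =
      ∑ x ∈ X, if x ∈ X₁ then (D.outdeg x : ℤ) - D.indeg x else D.indeg x - D.outdeg x := by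
  have ho : ∀ A ⊆ X, (D.e A Y : ℝ) = ∑ x ∈ A, (D.outdeg x : ℝ) := fun A hA => by
    rw [e_eq_sum]
    exact Finset.sum_congr rfl fun x hx => (outdeg_eq_sum_part hdisj hcover hX (hA hx)).symm
  have hi : ∀ A ⊆ X, (D.e Y A : ℝ) = ∑ x ∈ A, (D.indeg x : ℝ) := fun A hA => by
    rw [e_eq_sum, Finset.sum_comm]
    exact Finset.sum_congr rfl fun x hx => (indeg_eq_sum_part hdisj hcover hX (hA hx)).symm
  have : (D.gap Y X₁ (X \ X₁) : ℝ) = ∑ x ∈ X, if x ∈ X₁ then (D.outdeg x : ℝ) - D.indeg x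
      else D.indeg x - D.outdeg x := by
    rw [← Finset.sum_sdiff h,
      Finset.sum_congr (s₁ := X \ X₁) rfl fun x hx => if_neg (Finset.mem_sdiff.1 hx).2,
      Finset.sum_congr (s₁ := X₁) rfl fun x hx => if_pos hx, Finset.sum_sub_distrib,
      Finset.sum_sub_distrib, gap]
    push_cast
    rw [ho _ h, ho _ Finset.sdiff_subset, hi _ h, hi _ Finset.sdiff_subset]
    ring
  exact_mod_cast this

theorem minGap_le (hdisj : Disjoint X Y) (hcover : X ∪ Y = Finset.univ) (hX : D.e X X = 0)
    {σ : V → ℤ} (hσ : ∀ x ∈ X, σ x = 1 ∨ σ x = -1) :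
    D.minGap X Y ≤ |∑ x ∈ X, σ x * D.s x| := by
  -- The partition realising the signs `σ`. A vertex with `s x = 0` contributes zero on either side.
  have h : X.filter (fun x => σ x * D.s x = D.outdeg x - D.indeg x) ⊆ X := Finset.filter_subset _ _
  refine (Finset.inf'_le _ (Finset.mem_powerset.2 h)).trans_eq ?_
  rw [gap_eq_sum hdisj hcover hX h]
  congr 1
  refine Finset.sum_congr rfl fun x hx => ?_
  split_ifs with hm
  · exact (Finset.mem_filter.1 hm).2.symm
  · have hne : σ x * D.s x ≠ D.outdeg x - D.indeg x := fun he =>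
      hm (Finset.mem_filter.2 ⟨hx, he⟩)
    rw [s_eq_abs] at hne ⊢
    rcases hσ x hx with h1 | h1 <;> rw [h1] at hne ⊢ <;>
      rcases abs_choice ((D.outdeg x : ℤ) - D.indeg x) with h2 | h2 <;> rw [h2] at hne ⊢ <;>
      first | ring1 | exact absurd (by ring1) hne

theorem exists_minGap (hdisj : Disjoint X Y) (hcover : X ∪ Y = Finset.univ) (hX : D.e X X = 0) :
    ∃ c : V → Bool, D.minGap X Y =
      |∑ x ∈ X, if c x then (D.outdeg x : ℤ) - D.indeg x else D.indeg x - D.outdeg x| := by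
  obtain ⟨X₁, h, he⟩ := Finset.exists_mem_eq_inf' (Finset.powerset_nonempty X)
    fun X₁ => |D.gap Y X₁ (X \ X₁)|
  refine ⟨fun x => decide (x ∈ X₁), he.trans ?_⟩
  rw [gap_eq_sum hdisj hcover hX (Finset.mem_powerset.1 h)]
  simp

/-- Each signed sum of the imbalances of the huge vertices exceeds the minimum gap by the total
imbalance of the other vertices. -/
theorem minGap_add_gSum_le (hdisj : Disjoint X Y) (hcover : X ∪ Y = Finset.univ)
    (hX : D.e X X = 0) {σ : V → ℤ} (hσ : ∀ x ∈ D.huge X Y, σ x = 1 ∨ σ x = -1)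
    (h₀ : 0 ≤ ∑ x ∈ D.huge X Y, σ x * D.s x) :
    D.minGap X Y + D.gSum X Y ≤ ∑ x ∈ D.huge X Y, σ x * D.s x := by
  have hsub : D.huge X Y ⊆ X := Finset.filter_subset _ _
  refine add_sum_le_of_forall_le_abs h₀ (fun x _ => by rw [s_eq_abs]; exact abs_nonneg _)
    (fun x hx => ?_) fun T hT => ?_
  · obtain ⟨hxX, hx⟩ := Finset.mem_sdiff.1 hx
    by_contra! h
    exact hx (Finset.mem_filter.2 ⟨hxX, h⟩)
  · refine (minGap_le hdisj hcover hX (σ := fun x => if x ∈ D.huge X Y then σ x else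
      if x ∈ T then -1 else 1) fun x hx => ?_).trans_eq ?_
    · split_ifs with h h'
      exacts [hσ x h, Or.inr rfl, Or.inl rfl]
    · congr 1
      rw [← Finset.sum_sdiff hsub, add_comm]
      congr 1
      · exact Finset.sum_congr rfl fun x hx => by rw [if_pos hx]
      · rw [Finset.sum_congr rfl fun x hx => by rw [if_neg (Finset.mem_sdiff.1 hx).2],
          ← Finset.sum_sdiff hT, ← Finset.sum_sdiff hT,
          Finset.sum_congr (s₁ := T) rfl fun x hx => by rw [if_pos hx],
          Finset.sum_congr (s₁ := _ \ T) rfl fun x hx => by rw [if_neg (Finset.mem_sdiff.1 hx).2]]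
        simp only [one_mul, neg_one_mul, Finset.sum_neg_distrib]
        ring

end Parts

end Digraph

/-! ### The two cases, according to the size of `θ`. -/

namespace Digraph

theorem exists_partition_of_huge_card_eq_three {V : Type*} [Fintype V] [DecidableEq V]
    {D : Digraph V} (hloop : ∀ v, ¬ D.Adj v v) (hmin : ∀ v, 4 ≤ D.outdeg v) {X Y : Finset V}
    (hdisj : Disjoint X Y) (hcover : X ∪ Y = Finset.univ) (hX : D.e X X = 0) {ε : ℝ} (hε : 0 < ε)
    (hY : ∀ y ∈ Y, (D.deg y : ℝ) ≤ ε ^ 2 * (D.arcCount : ℝ) / 4)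
    (hhuge : (D.huge X Y).card = 3) :
    ∃ V₁ V₂ : Finset V, Disjoint V₁ V₂ ∧ V₁ ∪ V₂ = Finset.univ ∧
      (3 / 14 - ε) * (D.arcCount : ℝ) ≤ min (D.e V₁ V₂ : ℝ) (D.e V₂ V₁ : ℝ) := by
  obtain ⟨v₁, v₂, v₃, h₁₂, h₁₃, h₂₃, hv⟩ := Finset.card_eq_three.1 hhuge
  have hsub : D.huge X Y ⊆ X := Finset.filter_subset _ _
  have hsumH : ∀ f : V → ℝ, ∑ x ∈ D.huge X Y, f x = f v₁ + f v₂ + f v₃ := fun f => by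
    rw [hv, Finset.sum_insert (by simp [h₁₂, h₁₃]), Finset.sum_pair h₂₃, add_assoc]
  have hsumHZ : ∀ f : V → ℤ, ∑ x ∈ D.huge X Y, f x = f v₁ + f v₂ + f v₃ := fun f => by
    rw [hv, Finset.sum_insert (by simp [h₁₂, h₁₃]), Finset.sum_pair h₂₃, add_assoc]
  have hsumX : ∀ f : V → ℝ, ∑ x ∈ X, f x = f v₁ + f v₂ + f v₃ + ∑ x ∈ X \ D.huge X Y, f x :=
    fun f => by rw [← hsumH, add_comm, Finset.sum_sdiff hsub]
  have m₁ : v₁ ∈ D.huge X Y := by simp [hv]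
  have m₂ : v₂ ∈ D.huge X Y := by simp [hv]
  have m₃ : v₃ ∈ D.huge X Y := by simp [hv]
  have hE : (0 : ℝ) ≤ D.e Y Y := Nat.cast_nonneg _
  have hm := arcCount_eq_of_parts hdisj hcover hX
  set O : ℝ := ∑ x ∈ X \ D.huge X Y, (D.outdeg x : ℝ) with hO
  set I : ℝ := ∑ x ∈ X \ D.huge X Y, (D.indeg x : ℝ) with hI
  have hO₀ : 0 ≤ O := Finset.sum_nonneg fun _ _ => Nat.cast_nonneg _
  have hI₀ : 0 ≤ I := Finset.sum_nonneg fun _ _ => Nat.cast_nonneg _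
  have hN : (0 : ℝ) < Y.card := by
    have h1 := outdeg_le_card_part hdisj hcover hX (hsub m₁)
    have h2 : (4 : ℝ) ≤ D.outdeg v₁ := by exact_mod_cast hmin v₁
    linarith
  have hout : 4 * (Y.card : ℝ) ≤ D.e Y Y + ∑ x ∈ X, (D.indeg x : ℝ) := by
    rw [← sum_outdeg_part hdisj hcover hX, mul_comm, ← nsmul_eq_mul]
    exact Finset.card_nsmul_le_sum _ _ _ fun y _ => by exact_mod_cast hmin y
  have hmN : 4 * (Y.card : ℝ) ≤ D.arcCount := by
    rw [hm, Finset.sum_add_distrib]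
    have : (0 : ℝ) ≤ ∑ x ∈ X, (D.outdeg x : ℝ) := Finset.sum_nonneg fun _ _ => Nat.cast_nonneg _
    linarith
  rcases le_or_gt (7 * (D.minGap X Y : ℝ)) D.arcCount with hθ | hθ
  -- With `p = 1/2` the two expectations add up to `m/2` and differ by `θ/2` in absolute value, so
  -- each is at least `m/4 - m/28 = 3m/14`.
  · obtain ⟨c, hc⟩ := exists_minGap hdisj hcover hX
    have hc' : (D.minGap X Y : ℝ) =
        |∑ x ∈ X, if c x then (D.outdeg x : ℝ) - D.indeg x else D.indeg x - D.outdeg x| := by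
      rw [hc]
      push_cast
      rfl
    obtain ⟨k₁, k₂⟩ := abs_le.1 hc'.ge
    have hsum : (∑ x ∈ X, if c x then (1 - 1 / 2 : ℝ) * D.outdeg x else 1 / 2 * D.indeg x) +
        (∑ x ∈ X, if c x then (1 - 1 / 2 : ℝ) * D.indeg x else 1 / 2 * D.outdeg x) =
        (D.arcCount - D.e Y Y) / 2 := by
      rw [hm, add_sub_cancel_left, Finset.sum_div, ← Finset.sum_add_distrib]
      refine Finset.sum_congr rfl fun x _ => ?_
      split_ifs <;> ring
    have hdif : (∑ x ∈ X, if c x then (1 - 1 / 2 : ℝ) * D.outdeg x else 1 / 2 * D.indeg x) -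
        (∑ x ∈ X, if c x then (1 - 1 / 2 : ℝ) * D.indeg x else 1 / 2 * D.outdeg x) =
        (∑ x ∈ X, if c x then (D.outdeg x : ℝ) - D.indeg x else D.indeg x - D.outdeg x) / 2 := by
      rw [Finset.sum_div, ← Finset.sum_sub_distrib]
      refine Finset.sum_congr rfl fun x _ => ?_
      split_ifs <;> ring
    rw [sub_mul]
    exact exists_partition_of_sides hloop hdisj hcover hX hε hY (p := 1 / 2) (by norm_num)
      (by norm_num) c (by linarith) (by linarith)
  have hs : ∀ x, (D.s x : ℝ) = |(D.outdeg x : ℝ) - D.indeg x| := fun x => by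
    rw [s_eq_abs]
    push_cast
    rfl
  have hsN : ∀ x ∈ X, (D.s x : ℝ) ≤ Y.card := fun x hx => by
    have h1 := outdeg_le_card_part hdisj hcover hX hx
    have h2 := indeg_le_card_part hdisj hcover hX hx
    have h3 : (0 : ℝ) ≤ D.outdeg x := Nat.cast_nonneg _
    have h4 : (0 : ℝ) ≤ D.indeg x := Nat.cast_nonneg _
    rw [hs, abs_le]
    constructor <;> linarith
  have hθs : ∀ x ∈ D.huge X Y, (D.minGap X Y : ℝ) ≤ D.s x := fun x hx => by
    exact_mod_cast (Finset.mem_filter.1 hx).2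
  have hg : (D.gSum X Y : ℝ) = ∑ x ∈ X \ D.huge X Y, |(D.outdeg x : ℝ) - D.indeg x| := by
    rw [gSum]
    push_cast
    exact Finset.sum_congr rfl fun x _ => hs x
  have hg₀ : (0 : ℝ) ≤ D.gSum X Y := by
    rw [hg]
    exact Finset.sum_nonneg fun _ _ => abs_nonneg _
  have hOI : |O - I| ≤ D.gSum X Y := by
    rw [hg, hO, hI, ← Finset.sum_sub_distrib]
    exact Finset.abs_sum_le_sum_abs _ _
  -- Triangle-type inequality with slack: twice `s u` is subtracted from the total because the sign
  -- of `u` alone is reversed.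
  have hgap : ∀ u ∈ D.huge X Y, D.arcCount + 7 * (D.gSum X Y : ℝ) + 7 * (2 * (D.s u : ℝ)) <
      7 * (D.s v₁ + D.s v₂ + D.s v₃) := by
    intro u hu
    have hval : ∑ x ∈ D.huge X Y, (if x = u then -1 else 1) * D.s x =
        D.s v₁ + D.s v₂ + D.s v₃ - 2 * D.s u := by
      have : ∀ x, (if x = u then -1 else 1) * D.s x =
          D.s x - if x = u then 2 * D.s x else 0 := fun x => by split_ifs <;> ring
      simp_rw [this, Finset.sum_sub_distrib, hsumHZ D.s, Finset.sum_ite_eq', if_pos hu]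
    have hneg : ∑ x ∈ D.huge X Y, (if x = u then 1 else -1) * D.s x =
        -(D.s v₁ + D.s v₂ + D.s v₃ - 2 * D.s u) := by
      rw [← hval, ← Finset.sum_neg_distrib]
      refine Finset.sum_congr rfl fun x _ => ?_
      split_ifs <;> ring
    rcases le_total 0 (D.s v₁ + D.s v₂ + D.s v₃ - 2 * D.s u) with h | h
    · have := minGap_add_gSum_le hdisj hcover hX (σ := fun x => if x = u then -1 else 1)
        (fun x _ => by split_ifs <;> simp) (by rw [hval]; exact h)
      rw [hval] at this
      have : (D.minGap X Y : ℝ) + D.gSum X Y ≤ D.s v₁ + D.s v₂ + D.s v₃ - 2 * D.s u := by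
        exact_mod_cast this
      linarith
    -- Otherwise `s u` would exceed the other two by `θ + g`, so `s u ≥ 3θ > 3m/7`, contradicting `s
    -- u ≤ |Y| ≤ m/4`.
    · exfalso
      have := minGap_add_gSum_le hdisj hcover hX (σ := fun x => if x = u then 1 else -1)
        (fun x _ => by split_ifs <;> simp) (by rw [hneg]; linarith)
      rw [hneg] at this
      have : (D.minGap X Y : ℝ) + D.gSum X Y ≤ -(D.s v₁ + D.s v₂ + D.s v₃ - 2 * D.s u) := by
        exact_mod_cast this
      have k₁ := hθs v₁ m₁
      have k₂ := hθs v₂ m₂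
      have k₃ := hθs v₃ m₃
      have n := hsN u (hsub hu)
      linarith
  have g₁ := hgap v₁ m₁
  have g₂ := hgap v₂ m₂
  have g₃ := hgap v₃ m₃
  simp only [hs] at g₁ g₂ g₃
  rw [hsumX] at hout
  simp_rw [hsumX, Finset.sum_add_distrib] at hm
  have oN : ∀ x ∈ D.huge X Y, (D.outdeg x : ℝ) ≤ Y.card := fun x hx =>
    outdeg_le_card_part hdisj hcover hX (hsub hx)
  have iN : ∀ x ∈ D.huge X Y, (D.indeg x : ℝ) ≤ Y.card := fun x hx =>
    indeg_le_card_part hdisj hcover hX (hsub hx)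
  obtain ⟨c₁, c₂, c₃, c, hA, hB⟩ := exists_sides (m := D.arcCount) hN hE hO₀ hI₀ hOI
    (Nat.cast_nonneg _) (Nat.cast_nonneg _) (Nat.cast_nonneg _)
    (Nat.cast_nonneg _) (Nat.cast_nonneg _) (Nat.cast_nonneg _)
    (oN v₁ m₁) (oN v₂ m₂) (oN v₃ m₃) (iN v₁ m₁) (iN v₂ m₂) (iN v₃ m₃) hout hm
    (by linarith) (by linarith) (by linarith)
  set κ : V → Bool := fun x => if x = v₁ then c₁ else if x = v₂ then c₂ else if x = v₃ then c₃
    else c with hκ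
  have hside : ∀ a b : V → ℝ,
      (∑ x ∈ X, if κ x then (1 - 5 / 8 : ℝ) * a x else 5 / 8 * b x) =
        sideWeight c₁ (a v₁) (b v₁) + sideWeight c₂ (a v₂) (b v₂) + sideWeight c₃ (a v₃) (b v₃) +
          sideWeight c (∑ x ∈ X \ D.huge X Y, a x) (∑ x ∈ X \ D.huge X Y, b x) := by
    intro a b
    have hw : ∀ x, (if κ x then (1 - 5 / 8 : ℝ) * a x else 5 / 8 * b x) =
        sideWeight (κ x) (a x) (b x) := fun x => by
      rw [sideWeight]
      norm_num
    have hrest : ∑ x ∈ X \ D.huge X Y, sideWeight (κ x) (a x) (b x) =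
        sideWeight c (∑ x ∈ X \ D.huge X Y, a x) (∑ x ∈ X \ D.huge X Y, b x) := by
      have : ∀ x ∈ X \ D.huge X Y, sideWeight (κ x) (a x) (b x) = sideWeight c (a x) (b x) := by
        intro x hx
        have hx' := (Finset.mem_sdiff.1 hx).2
        simp only [hv, Finset.mem_insert, Finset.mem_singleton, not_or] at hx'
        simp [hκ, hx'.1, hx'.2.1, hx'.2.2]
      rw [Finset.sum_congr rfl this]
      cases c <;> simp [sideWeight, Finset.mul_sum]
    simp_rw [hw]
    rw [hsumX, hrest]
    simp [hκ, h₁₂.symm, h₁₃.symm, h₂₃.symm]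
  rw [sub_mul]
  refine exists_partition_of_sides hloop hdisj hcover hX hε hY (p := 5 / 8) (by norm_num)
    (by norm_num) κ ?_ ?_
  · rw [hside fun x => (D.outdeg x : ℝ)]
    linarith
  · rw [hside fun x => (D.indeg x : ℝ)]
    linarith

end Digraph
theorem lemma4p4 {V : Type*} [Fintype V] [DecidableEq V] (D : Digraph V)
    (hloop : ∀ v, ¬ D.Adj v v)
    (d : ℕ) (hd : 4 ≤ d) (hmin : IsLeast (Set.range D.outdeg) d)
    (X Y : Finset V) (hdisj : Disjoint X Y) (hcover : X ∪ Y = Finset.univ)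
    (hX : D.e X X = 0)
    (ε : ℝ) (hε : 0 < ε)
    (hY : ∀ y ∈ Y, (D.deg y : ℝ) ≤ ε ^ 2 * (D.arcCount : ℝ) / 4)
    (hhuge : (D.huge X Y).card = 3) :
    (∃ V₁ V₂ : Finset V, Disjoint V₁ V₂ ∧ V₁ ∪ V₂ = Finset.univ ∧
      (3 / 14 - ε) * (D.arcCount : ℝ) ≤ min (D.e V₁ V₂ : ℝ) (D.e V₂ V₁ : ℝ)) ∨
    (∀ v₁ v₂ v₃ : V, D.huge X Y = {v₁, v₂, v₃} → D.s v₂ ≤ D.s v₁ → D.s v₃ ≤ D.s v₂ →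
      D.bHalf X < 3 * (D.s v₂ : ℝ) + 3 * (D.s v₃ : ℝ) - 4 * (D.s v₁ : ℝ)
        - 4 * (D.gSum X Y : ℝ) - (D.e Y Y : ℝ) / 2
        - 7 * ((Fintype.card V : ℝ) - ((D.inducedOn Y).essentialTightCount : ℝ)) / 4) := by
  obtain ⟨-, hd'⟩ := hmin
  exact Or.inl (Digraph.exists_partition_of_huge_card_eq_three hloop
    (fun v => hd.trans (hd' (Set.mem_range_self v))) hdisj hcover hX hε hY hhuge)
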